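/- Let $\vec G$ be a finite connected symmetric digraph (no loops, no parallel arcs; $uv$ is an arc if and only if $vu$ is) with at least two vertices, and let $c$ assign a positive integer $c_{uv}$ to each arc $uv$. *Circular chromatic number.* For a real $p>0$ identify the circle $S^p$ of perimeter $p$ with $[0,p)$, and let $d(x,y)$ be $y-x$ if $x\le y$ and $p-(x-y)$ if $x>y$ (the length of the arc from $x$ to $y$ in the clockwise direction). A circular $p$-coloring of $(\vec G,c)$ is a map $\varphi:V(\vec G)\to S^p$ with $d(\varphi(u),\varphi(v))\ge c_{uv}$ for each arc $uv$, and $\chi_c(\vec G,c)$ is the infimum of all $p>0$ for which $(\vec G,c)$ has a circular $p$-coloring. *Token game.* A good initial marking $T$ assigns a nonnegative integer $T_{uv}$ (a number of tokens) to each arc $uv$ such that $T_{uv}+T_{vu}=1$ for each arc $uv$ and $\sum_{uv\in E(C)}T_{uv}>0$ for each directed cycle $C$ of $\vec G$ (directed cycles of length two included). The game starts at time $t=1$ with $T_{uv}$ tokens on each arc $uv$. A vertex is fireable at time $t$ if each arc $uv$ into it contains at least one token at time $t$. At each time $t=1,2,3,\dots$ all fireable vertices fire simultaneously: a vertex $u$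 that fires at time $t$ removes one token from each of its in-arcs, and for each out-arc $uv$ it places one token on $uv$ at time $t+c_{uv}$ (available from that time on). Let $h(t)$ be the set of vertices fireable at time $t$. **Theorem.** For each good initial marking $T$ the game is eventually periodic: there are positive integers $p$ and $M$ with $h(t+p)=h(t)$ for all $t\ge M$. Let $p_{(\vec G,c,T)}$ be the least such $p$ and let $M$ belong to it. The number of times $t\in[M,M+p_{(\vec G,c,T)})$ with $u\in h(t)$ is positive and is the same for all vertices $u$; denote it by $m_{(\vec G,c,T)}$. Moreover, $$\chi_c(\vec G,c)=\min_{T}\frac{p_{(\vec G,c,T)}}{m_{(\vec G,c,T)}},$$ where the minimum is taken over all good initial markings $T$ of $(\vec G,c)$, and is attained. -/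

import Mathlib

/-!
A symmetric digraph without loops and parallel arcs is the same thing as a `SimpleGraph`: its arcs
are the ordered pairs `(u, v)` with `G.Adj u v`, that is, the darts of the graph. A directed walk
is a `SimpleGraph.Walk`. Weights and markings are functions of two vertices of which only the
values on arcs matter.
-/

namespace TokenGame

variable {V : Type*}

/-- The length `d(x, y)` of the arc from `x` to `y` in the positive (clockwise) direction on the
circle of perimeter `p`, which is identified with `[0, p)`. -/
noncomputable def circDist (p x y : ℝ) : ℝ :=
  if x ≤ y then y - x else p - (x - y)

/-- `φ` is a circular `p`-coloring of the symmetric digraph `G` with arc weights `c`. -/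
def IsCircularColoring (G : SimpleGraph V) (c : V → V → ℝ) (p : ℝ) (φ : V → ℝ) : Prop :=
  (∀ u, φ u ∈ Set.Ico 0 p) ∧ ∀ u v, G.Adj u v → c u v ≤ circDist p (φ u) (φ v)

/-- The circular chromatic number of the symmetric digraph `G` with arc weights `c`. -/
noncomputable def circularChromaticNumber (G : SimpleGraph V) (c : V → V → ℝ) : ℝ :=
  sInf {p : ℝ | 0 < p ∧ ∃ φ : V → ℝ, IsCircularColoring G c p φ}

/-- A directed cycle: a closed directed walk of positive length without repeated vertices, except
that its first vertex is its last one. Cycles `u v u` of length two are included. -/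
def IsDicycle {G : SimpleGraph V} {u : V} (C : G.Walk u u) : Prop :=
  0 < C.length ∧ C.support.tail.Nodup

/-- The token count of a walk. -/
def tokenCount {G : SimpleGraph V} (T : V → V → ℕ) {u v : V} (C : G.Walk u v) : ℕ :=
  (C.darts.map fun a => T a.fst a.snd).sum

/-- A good initial marking: each directed cycle carries a token, and each pair of opposite arcs
carries exactly one. -/
def IsGood (G : SimpleGraph V) (T : V → V → ℕ) : Prop :=
  (∀ (u : V) (C : G.Walk u u), IsDicycle C → 0 < tokenCount T C) ∧
    ∀ u v, G.Adj u v → T u v + T v u = 1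

/-- A state of the token game at a time pulse: `tokens u v` is the number of tokens on the arc
`uv`, and `transit u v k` is the number of tokens which, because of earlier firings of `u`, will be
placed on the arc `uv` exactly `k + 1` time pulses later. -/
structure State (V : Type*) where
  tokens : V → V → ℕ
  transit : V → V → ℕ → ℕ

/-- A vertex is fireable if each of its in-arcs contains at least one token. -/
def State.Fireable (G : SimpleGraph V) (s : State V) (v : V) : Prop :=
  ∀ u, G.Adj u v → 0 < s.tokens u v

open Classical in
/-- The tokens under way right after all the fireable vertices have fired: a vertex `u` that fires
now places a token on each out-arc `uv` after `c u v` time pulses. -/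
noncomputable def State.enRoute (G : SimpleGraph V) (c : V → V → ℕ) (s : State V)
    (u v : V) (k : ℕ) : ℕ :=
  s.transit u v k + if s.Fireable G u ∧ c u v = k + 1 then 1 else 0

open Classical in
/-- One time pulse of the token game: all fireable vertices fire simultaneously, each removing one
token from each of its in-arcs; then time moves on to the next pulse, at which the tokens that are
due are placed. -/
noncomputable def State.next (G : SimpleGraph V) (c : V → V → ℕ) (s : State V) : State V where
  tokens u v := (s.tokens u v - if s.Fireable G v then 1 else 0) + s.enRoute G c u v 0
  transit u v k := s.enRoute G c u v (k + 1)

/-- The state in which the token game starts: the initial marking, and no tokens under way. -/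
def initialState (T : V → V → ℕ) : State V where
  tokens := T
  transit _ _ _ := 0

/-- The set `h(t)` of the vertices that are fireable (and fire) at time pulse `t`. The game starts
at the time pulse `1`; only `t ≥ 1` is meaningful. -/
def fireSet (G : SimpleGraph V) (c T : V → V → ℕ) (t : ℕ) : Set V :=
  {v | ((State.next G c)^[t - 1] (initialState T)).Fireable G v}

/-- From time pulse `M` on, the token game repeats itself every `p` pulses. -/
def IsPeriodicFrom (G : SimpleGraph V) (c T : V → V → ℕ) (p M : ℕ) : Prop :=
  0 < p ∧ 0 < M ∧ ∀ t, M ≤ t → fireSet G c T (t + p) = fireSet G c T t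

/-- The period of the token game: the least `p > 0` for which the game is eventually
`p`-periodic. -/
noncomputable def period (G : SimpleGraph V) (c T : V → V → ℕ) : ℕ :=
  sInf {p | ∃ M, IsPeriodicFrom G c T p M}

/-- The first time pulse from which on the token game is periodic with its period. -/
noncomputable def steadyTime (G : SimpleGraph V) (c T : V → V → ℕ) : ℕ :=
  sInf {M | IsPeriodicFrom G c T (period G c T) M}

open Classical in
/-- The number of times that the vertex `u` is fireable during one period of the steady state. -/
noncomputable def multiplicity (G : SimpleGraph V) (c T : V → V → ℕ) (u : V) : ℕ :=
  ((Finset.Ico (steadyTime G c T) (steadyTime G c T + period G c T)).filter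
    fun t => u ∈ fireSet G c T t).card

end TokenGame

/-!
Everything rests on potentials of slope `r`, that is, real functions with
`y u + c u v ≤ y v + r * T u v` on the arcs. Let `N v n` count the firings of `v` up to time `n`.

Since `N v (n + c u v) ≤ T u v + N u n` on the arcs, the suprema over `n` of `n - r * N v n` form a
potential whenever they are finite. Conversely, a potential of slope `r ≥ 1` bounds `n - r * N v n`,
because a vertex which does not fire is held up by an in-neighbour. As the game repeats itself,
`N v` grows by the multiplicity in each period, so these suprema are finite if and only if the
period is at most `r` times the multiplicity. If each directed cycle carries a token, then the
arcs without tokens are acyclic and a topological ranking, suitably scaled, is a potential; hence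
the multiplicity is positive.

If opposite arcs carry exactly one token together, then a potential of slope `r`, reduced modulo
`r`, is a circular `r`-coloring. Conversely, a circular `r`-coloring is a potential of slope `r` for
the good marking with tokens on the arcs along which it descends.
-/

namespace TokenGame

theorem bddAbove_range_iff_of_add_eq {α : Type*} [AddCommGroup α] [LinearOrder α]
    [IsOrderedAddMonoid α] [Archimedean α] {a : ℕ → α} {n₀ p : ℕ} {d : α} (hp : 0 < p)
    (h : ∀ n, n₀ ≤ n → a (n + p) = a n + d) : BddAbove (Set.range a) ↔ d ≤ 0 := by
  constructor
  · rintro ⟨B, hB⟩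
    have hiter : ∀ j : ℕ, a (n₀ + j * p) = a n₀ + j • d := by
      intro j
      induction j with
      | zero => simp
      | succ j ih => rw [add_one_mul, ← add_assoc, h _ (Nat.le_add_right _ _), ih, succ_nsmul,
          add_assoc]
    by_contra! hd
    obtain ⟨j, hj⟩ := exists_lt_nsmul hd (B - a n₀)
    exact (sub_lt_iff_lt_add'.1 hj).not_ge (hiter j ▸ hB ⟨_, rfl⟩)
  · intro hd
    obtain ⟨B, hB⟩ := ((Finset.range (n₀ + p)).image a).exists_le
    refine ⟨B, Set.forall_mem_range.2 fun n => ?_⟩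
    induction n using Nat.strong_induction_on with
    | _ n ih =>
      rcases lt_or_ge n (n₀ + p) with hn | hn
      · exact hB _ (Finset.mem_image_of_mem a (Finset.mem_range.2 hn))
      · calc a n = a (n - p + p) := by rw [Nat.sub_add_cancel (by omega)]
          _ = a (n - p) + d := h _ (by omega)
          _ ≤ a (n - p) := add_le_of_nonpos_right hd
          _ ≤ B := ih _ (by omega)

section Counting

variable {G : SimpleGraph V} {c T : V → V → ℕ}

/-- The state of the token game after `n` time pulses, that is, at the time pulse `n + 1`. -/
noncomputable def stateAt (G : SimpleGraph V) (c T : V → V → ℕ) (n : ℕ) : State V :=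
  (State.next G c)^[n] (initialState T)

open Classical in
/-- The number of times that `u` fires during the first `n` time pulses. The whole analysis of the
game is carried out in terms of these counters. -/
noncomputable def firings (G : SimpleGraph V) (c T : V → V → ℕ) (u : V) (n : ℕ) : ℕ :=
  Nat.count (fun i => (stateAt G c T i).Fireable G u) n

theorem stateAt_succ (n : ℕ) : stateAt G c T (n + 1) = (stateAt G c T n).next G c :=
  Function.iterate_succ_apply' _ _ _

theorem mem_fireSet_succ {n : ℕ} {u : V} :
    u ∈ fireSet G c T (n + 1) ↔ (stateAt G c T n).Fireable G u :=
  Iff.rfl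

open Classical in
@[simp]
theorem firings_zero (u : V) : firings G c T u 0 = 0 :=
  Nat.count_zero _

open Classical in
theorem firings_succ (u : V) (n : ℕ) : firings G c T u (n + 1) =
    firings G c T u n + if (stateAt G c T n).Fireable G u then 1 else 0 :=
  Nat.count_succ _ _

open Classical in
theorem firings_mono (u : V) : Monotone (firings G c T u) :=
  Nat.count_monotone _

open Classical in
theorem State.sum_enRoute {s : State V} {u v : V} (hc : 0 < c u v) (k : ℕ) :
    ∑ j ∈ Finset.range k, s.enRoute G c u v j =
      ∑ j ∈ Finset.range k, s.transit u v j + if s.Fireable G u ∧ c u v ≤ k then 1 else 0 := by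
  induction k with
  | zero => simp [hc.ne']
  | succ k ih =>
    rw [Finset.sum_range_succ, Finset.sum_range_succ, ih, State.enRoute]
    by_cases hu : s.Fireable G u <;> simp only [hu, true_and, false_and, if_false]
    · split_ifs <;> omega
    · omega

-- On the right, `n + k + 1 - c u v` counts the pulses at which a firing of `u` delivers within the
-- next `k` pulses, and the `min` keeps those firings that have already happened.
theorem tokens_add_sum_transit_add_firings {u v : V} (huv : G.Adj u v) (hc : 0 < c u v) (n k : ℕ) :
    (stateAt G c T n).tokens u v + ∑ j ∈ Finset.range k, (stateAt G c T n).transit u v j +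
        firings G c T v n =
      T u v + firings G c T u (min n (n + k + 1 - c u v)) := by
  classical
  induction n generalizing k with
  | zero => simp [stateAt, initialState]
  | succ n ih =>
    have hplaced : firings G c T u (min (n + 1) (n + 1 + k + 1 - c u v)) =
        firings G c T u (min n (n + (k + 1) + 1 - c u v)) +
          if (stateAt G c T n).Fireable G u ∧ c u v ≤ k + 1 then 1 else 0 := by
      by_cases hk : c u v ≤ k + 1
      · rw [min_eq_left (by omega), min_eq_left (by omega), firings_succ]
        simp only [hk, and_true]
      · rw [min_eq_right (by omega), min_eq_right (by omega), if_neg fun h => hk h.2]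
        congr 1
        omega
    have htotal := State.sum_enRoute (G := G) (s := stateAt G c T n) hc (k + 1)
    rw [Finset.sum_range_succ'] at htotal
    have hremove : (if (stateAt G c T n).Fireable G v then 1 else 0) ≤
        (stateAt G c T n).tokens u v := by
      split_ifs with hv
      exacts [hv u huv, Nat.zero_le _]
    have := ih (k + 1)
    rw [stateAt_succ, firings_succ v, hplaced]
    simp only [State.next]
    omega

theorem tokens_add_firings {u v : V} (huv : G.Adj u v) (hc : 0 < c u v) (n : ℕ) :
    (stateAt G c T n).tokens u v + firings G c T v n = T u v + firings G c T u (n + 1 - c u v) := by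
  have h := tokens_add_sum_transit_add_firings (T := T) huv hc n 0
  rwa [Finset.sum_range_zero, add_zero, add_zero, min_eq_right (by omega)] at h

theorem firings_add_weight_le {u v : V} (huv : G.Adj u v) (hc : 0 < c u v) (n : ℕ) :
    firings G c T v (n + c u v) ≤ T u v + firings G c T u n := by
  obtain ⟨d, hd⟩ := Nat.exists_eq_add_of_lt hc
  have h := tokens_add_firings (T := T) huv hc (n + d)
  rw [show n + d + 1 - c u v = n by omega] at h
  rw [show n + c u v = n + d + 1 by omega, firings_succ]
  split_ifs with hv
  · have := hv u huv
    omega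
  · omega

theorem firings_le {u v : V} (huv : G.Adj u v) (hc : 0 < c u v) (n : ℕ) :
    firings G c T v n ≤ T u v + firings G c T u n :=
  (firings_mono v (Nat.le_add_right n _)).trans (firings_add_weight_le huv hc n)

theorem exists_firings_eq_of_not_fireable (hc : ∀ u v, G.Adj u v → 0 < c u v) {v : V} {n : ℕ}
    (h : ¬ (stateAt G c T n).Fireable G v) :
    ∃ u, G.Adj u v ∧ firings G c T v n = T u v + firings G c T u (n + 1 - c u v) := by
  simp only [State.Fireable, not_forall, not_lt, nonpos_iff_eq_zero] at h
  obtain ⟨u, huv, h0⟩ := h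
  exact ⟨u, huv, by rw [← tokens_add_firings huv (hc u v huv), h0, zero_add]⟩

end Counting

section Periodicity

variable {G : SimpleGraph V} {c T : V → V → ℕ}

theorem tokens_add_sum_transit_le (hc : ∀ u v, G.Adj u v → 0 < c u v) {u v : V}
    (huv : G.Adj u v) (n k : ℕ) :
    (stateAt G c T n).tokens u v + ∑ j ∈ Finset.range k, (stateAt G c T n).transit u v j ≤
      T u v + T v u := by
  have hcount := tokens_add_sum_transit_add_firings (T := T) huv (hc u v huv) n k
  have hmono := firings_mono (G := G) (c := c) (T := T) u (min_le_left n (n + k + 1 - c u v))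
  have hback := firings_le (T := T) huv.symm (hc v u huv.symm) n
  omega

theorem transit_le (hc : ∀ u v, G.Adj u v → 0 < c u v) {u v : V} (huv : G.Adj u v) (n k : ℕ) :
    (stateAt G c T n).transit u v k ≤ T u v + T v u := by
  have h := tokens_add_sum_transit_le (T := T) hc huv n (k + 1)
  rw [Finset.sum_range_succ] at h
  omega

theorem transit_eq_zero {u v : V} (huv : G.Adj u v) (hc : 0 < c u v) {k : ℕ} (hk : c u v ≤ k)
    (n : ℕ) : (stateAt G c T n).transit u v k = 0 := by
  have h₁ := tokens_add_sum_transit_add_firings (T := T) huv hc n k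
  have h₂ := tokens_add_sum_transit_add_firings (T := T) huv hc n (k + 1)
  rw [min_eq_left (by omega)] at h₁ h₂
  rw [Finset.sum_range_succ] at h₂
  omega

/-- Two states agree if they carry the same tokens, present and under way, on the arcs. The values
off the arcs are irrelevant to the game and may be unbounded. -/
def State.AgreeOn (G : SimpleGraph V) (s s' : State V) : Prop :=
  ∀ u v, G.Adj u v → s.tokens u v = s'.tokens u v ∧ ∀ k, s.transit u v k = s'.transit u v k

theorem State.AgreeOn.fireable_eq {s s' : State V} (h : s.AgreeOn G s') :
    s.Fireable G = s'.Fireable G :=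
  funext fun v => propext <| forall₂_congr fun u huv => by rw [(h u v huv).1]

theorem State.AgreeOn.next {s s' : State V} (h : s.AgreeOn G s') :
    (s.next G c).AgreeOn G (s'.next G c) := by
  intro u v huv
  obtain ⟨htokens, htransit⟩ := h u v huv
  simp only [State.next, State.enRoute, htokens, htransit]
  rw [h.fireable_eq]
  exact ⟨rfl, fun _ => rfl⟩

theorem State.AgreeOn.stateAt_add {i j : ℕ} (h : (stateAt G c T i).AgreeOn G (stateAt G c T j))
    (n : ℕ) : (stateAt G c T (i + n)).AgreeOn G (stateAt G c T (j + n)) := by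
  induction n with
  | zero => exact h
  | succ n ih =>
    rw [← add_assoc, ← add_assoc, stateAt_succ, stateAt_succ]
    exact ih.next

theorem exists_lt_agreeOn [Finite V] (hc : ∀ u v, G.Adj u v → 0 < c u v) (T : V → V → ℕ) :
    ∃ i j, i < j ∧ (stateAt G c T i).AgreeOn G (stateAt G c T j) := by
  obtain ⟨K, hK⟩ := Finite.bddAbove_range fun a : V × V => c a.1 a.2
  let contents (n : ℕ) (a : {a : V × V // G.Adj a.1 a.2}) : ℕ × (Fin K → ℕ) :=
    ((stateAt G c T n).tokens a.1.1 a.1.2, fun k => (stateAt G c T n).transit a.1.1 a.1.2 k)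
  let bound (a : {a : V × V // G.Adj a.1 a.2}) : ℕ := T a.1.1 a.1.2 + T a.1.2 a.1.1
  let bounded (a : {a : V × V // G.Adj a.1 a.2}) : Set (ℕ × (Fin K → ℕ)) :=
    Set.Iic (bound a) ×ˢ {g | ∀ k, g k ∈ Set.Iic (bound a)}
  have hmem : ∀ n a, contents n a ∈ bounded a := fun n a =>
    ⟨(Nat.le_add_right _ _).trans (tokens_add_sum_transit_le hc a.2 n 0),
      fun k => transit_le hc a.2 n k⟩
  have hfin : {f : _ → ℕ × (Fin K → ℕ) | ∀ a, f a ∈ bounded a}.Finite :=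
    Set.Finite.pi' fun a => (Set.finite_Iic _).prod (Set.Finite.pi' fun _ => Set.finite_Iic _)
  obtain ⟨i, j, hij, heq⟩ := hfin.exists_lt_map_eq_of_forall_mem hmem
  refine ⟨i, j, hij, fun u v huv => ?_⟩
  obtain ⟨htokens, htransit⟩ := Prod.ext_iff.1 (congrFun heq ⟨(u, v), huv⟩)
  refine ⟨htokens, fun k => ?_⟩
  rcases lt_or_ge k K with hk | hk
  · exact congrFun htransit ⟨k, hk⟩
  · have hck : c u v ≤ k := (hK ⟨(u, v), rfl⟩).trans hk
    rw [transit_eq_zero huv (hc u v huv) hck, transit_eq_zero huv (hc u v huv) hck]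

theorem exists_isPeriodicFrom [Finite V] (hc : ∀ u v, G.Adj u v → 0 < c u v) (T : V → V → ℕ) :
    ∃ p M, IsPeriodicFrom G c T p M := by
  obtain ⟨i, j, hij, hagree⟩ := exists_lt_agreeOn hc T
  refine ⟨j - i, i + 1, by omega, by omega, fun t ht => ?_⟩
  obtain ⟨n, rfl⟩ := Nat.exists_eq_add_of_le ht
  ext v
  rw [show i + 1 + n + (j - i) = j + n + 1 by omega, show i + 1 + n = i + n + 1 by omega,
    mem_fireSet_succ, mem_fireSet_succ, (hagree.stateAt_add n).fireable_eq]

theorem isPeriodicFrom_period_steadyTime [Finite V] (hc : ∀ u v, G.Adj u v → 0 < c u v)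
    (T : V → V → ℕ) : IsPeriodicFrom G c T (period G c T) (steadyTime G c T) :=
  Nat.sInf_mem (s := {M | IsPeriodicFrom G c T (period G c T) M})
    (Nat.sInf_mem (s := {p | ∃ M, IsPeriodicFrom G c T p M}) (exists_isPeriodicFrom hc T))

theorem period_pos [Finite V] (hc : ∀ u v, G.Adj u v → 0 < c u v) (T : V → V → ℕ) :
    0 < period G c T :=
  (isPeriodicFrom_period_steadyTime hc T).1

theorem exists_firings_add_period [Finite V] (hc : ∀ u v, G.Adj u v → 0 < c u v)
    (T : V → V → ℕ) : ∃ n₀, ∀ u n, n₀ ≤ n →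
      firings G c T u (n + period G c T) = firings G c T u n + multiplicity G c T u := by
  classical
  obtain ⟨-, hM, hper⟩ := isPeriodicFrom_period_steadyTime hc T
  obtain ⟨n₀, hn₀⟩ := Nat.exists_eq_add_of_lt hM
  refine ⟨n₀, fun u n hn => ?_⟩
  induction n, hn using Nat.le_induction with
  | base =>
    rw [firings, Nat.count_add, ← firings, multiplicity, Nat.count_eq_card_filter_range,
      Finset.card_filter, Finset.card_filter, Finset.sum_Ico_eq_sum_range, Nat.add_sub_cancel_left]
    simp only [hn₀, zero_add, Nat.add_right_comm n₀ 1, mem_fireSet_succ]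
  | succ n hn ih =>
    have hfire : (stateAt G c T (n + period G c T)).Fireable G u ↔
        (stateAt G c T n).Fireable G u := by
      rw [← mem_fireSet_succ, ← mem_fireSet_succ, ← hper (n + 1) (by omega), Nat.add_right_comm]
    rw [Nat.add_right_comm, firings_succ, firings_succ, ih, if_congr hfire rfl rfl,
      Nat.add_right_comm]

theorem multiplicity_le_of_adj [Finite V] (hc : ∀ u v, G.Adj u v → 0 < c u v) {u v : V}
    (huv : G.Adj u v) : multiplicity G c T v ≤ multiplicity G c T u := by
  obtain ⟨n₀, hn₀⟩ := exists_firings_add_period hc T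
  have hbdd : BddAbove (Set.range fun n => (firings G c T v n : ℤ) - firings G c T u n) := by
    refine ⟨T u v, Set.forall_mem_range.2 fun n => ?_⟩
    have := firings_le (T := T) huv (hc u v huv) n
    omega
  have hslope := (bddAbove_range_iff_of_add_eq (n₀ := n₀)
    (d := (multiplicity G c T v : ℤ) - multiplicity G c T u) (period_pos hc T) fun n hn => by
      rw [hn₀ u n hn, hn₀ v n hn]
      push_cast
      ring).1 hbdd
  omega

theorem multiplicity_eq [Finite V] (hG : G.Preconnected) (hc : ∀ u v, G.Adj u v → 0 < c u v)
    (T : V → V → ℕ) (u v : V) : multiplicity G c T u = multiplicity G c T v := by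
  obtain ⟨w⟩ := hG u v
  induction w with
  | nil => rfl
  | cons huv _ ih =>
    exact ((multiplicity_le_of_adj hc huv.symm).antisymm (multiplicity_le_of_adj hc huv)).trans ih

end Periodicity

section Potentials

variable {G : SimpleGraph V} {T : V → V → ℕ}

/-- A potential of slope `r` for a marking `T`: a schedule in which `u` is allowed to fire at the
times `y u + k * r`, so that the tokens which it places on `uv` are there when `v` needs them. -/
def IsPotential (G : SimpleGraph V) (c : V → V → ℝ) (T : V → V → ℕ) (r : ℝ) (y : V → ℝ) : Prop :=
  ∀ u v, G.Adj u v → y u + c u v ≤ y v + r * T u v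

theorem IsPotential.sub_mul_firings_le {c : V → V → ℕ} (hc : ∀ u v, G.Adj u v → 0 < c u v)
    {r b : ℝ} {y : V → ℝ} (hr : 1 ≤ r) (hy : IsPotential G (fun u v => c u v) T r y)
    (hb : ∀ v, b ≤ y v) (n : ℕ) (v : V) : n - r * firings G c T v n ≤ y v - b := by
  induction n using Nat.strong_induction_on generalizing v with
  | _ n ih =>
    rcases n with _ | n
    · simpa using hb v
    by_cases hv : (stateAt G c T n).Fireable G v
    · have := ih n n.lt_succ_self v
      rw [firings_succ, if_pos hv]
      push_cast
      linarith
    · obtain ⟨u, huv, hu⟩ := exists_firings_eq_of_not_fireable hc hv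
      have hyuv := hy u v huv
      have hcuv := hc u v huv
      rw [firings_succ, if_neg hv, add_zero, hu]
      rcases le_or_gt (c u v) (n + 1) with hle | hgt
      · have := ih (n + 1 - c u v) (by omega) u
        push_cast [Nat.cast_sub hle] at this ⊢
        linarith
      · have hgt' : (n : ℝ) + 1 < c u v := by exact_mod_cast hgt
        have := hb u
        rw [show n + 1 - c u v = 0 by omega, firings_zero]
        push_cast
        linarith

theorem bddAbove_range_sub_mul_firings_iff [Finite V] {c : V → V → ℕ}
    (hc : ∀ u v, G.Adj u v → 0 < c u v) (r : ℝ) (v : V) :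
    BddAbove (Set.range fun n : ℕ => (n : ℝ) - r * firings G c T v n) ↔
      period G c T ≤ r * multiplicity G c T v := by
  obtain ⟨n₀, hn₀⟩ := exists_firings_add_period hc T
  refine (bddAbove_range_iff_of_add_eq (n₀ := n₀) (period_pos hc T) fun n hn => ?_).trans
    sub_nonpos
  rw [hn₀ v n hn]
  push_cast
  ring

theorem IsPotential.period_le [Finite V] {c : V → V → ℕ} (hc : ∀ u v, G.Adj u v → 0 < c u v)
    {r : ℝ} {y : V → ℝ} (hr : 1 ≤ r) (hy : IsPotential G (fun u v => c u v) T r y) (v : V) :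
    period G c T ≤ r * multiplicity G c T v := by
  have : Nonempty V := ⟨v⟩
  obtain ⟨w, hw⟩ := Finite.exists_min y
  exact (bddAbove_range_sub_mul_firings_iff hc r v).1
    ⟨y v - y w, Set.forall_mem_range.2 fun n => hy.sub_mul_firings_le hc hr hw n v⟩

theorem exists_isPotential_of_period_le [Finite V] {c : V → V → ℕ}
    (hc : ∀ u v, G.Adj u v → 0 < c u v) {r : ℝ} (hr : 0 ≤ r)
    (h : ∀ v, period G c T ≤ r * multiplicity G c T v) :
    ∃ y, IsPotential G (fun u v => c u v) T r y := by
  -- The potential of `v` is its largest delay behind a schedule with one firing every `r` pulses.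
  have hbdd := fun v => (bddAbove_range_sub_mul_firings_iff hc r v).2 (h v)
  refine ⟨fun v => ⨆ n : ℕ, ((n : ℝ) - r * firings G c T v n), fun u v huv => ?_⟩
  rw [← le_sub_iff_add_le]
  refine ciSup_le fun n => ?_
  have hsup := le_ciSup (hbdd v) (n + c u v)
  have hfirings : (firings G c T v (n + c u v) : ℝ) ≤ T u v + firings G c T u n := by
    exact_mod_cast firings_add_weight_le huv (hc u v huv) n
  have := mul_le_mul_of_nonneg_left hfirings hr
  push_cast at hsup
  linarith

end Potentials

section Liveness

variable {G : SimpleGraph V} {T : V → V → ℕ}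

/-- A live marking: each directed cycle carries a token. This is the first half of `IsGood`. -/
def IsLive (G : SimpleGraph V) (T : V → V → ℕ) : Prop :=
  ∀ (u : V) (C : G.Walk u u), IsDicycle C → 0 < tokenCount T C

theorem tokenCount_cons {u v w : V} (huv : G.Adj u v) (p : G.Walk v w) :
    tokenCount T (p.cons huv) = T u v + tokenCount T p := by
  simp only [tokenCount, SimpleGraph.Walk.darts_cons, List.map_cons, List.sum_cons]

theorem tokenCount_eq_zero_iff {u v : V} {p : G.Walk u v} :
    tokenCount T p = 0 ↔ ∀ d ∈ p.darts, T d.fst d.snd = 0 := by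
  simp only [tokenCount, List.sum_eq_zero_iff, List.forall_mem_map]

theorem IsLive.tokenCount_pos (hT : IsLive G T) {u : V} (C : G.Walk u u) (hC : 0 < C.length) :
    0 < tokenCount T C := by
  classical
  cases C with
  | nil => exact absurd hC (lt_irrefl 0)
  | cons huv p =>
    have hcycle := hT _ (p.bypass.cons huv) ⟨Nat.succ_pos _, p.bypass_isPath.support_nodup⟩
    rw [tokenCount_cons] at hcycle ⊢
    by_contra! h0
    have hp : tokenCount T p = 0 := by omega
    have hbypass : tokenCount T p.bypass = 0 := tokenCount_eq_zero_iff.2 fun d hd =>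
      tokenCount_eq_zero_iff.1 hp d (p.darts_bypass_subset_darts hd)
    omega

theorem exists_walk_tokenCount_eq_zero {u v : V}
    (h : Relation.TransGen (fun u v => G.Adj u v ∧ T u v = 0) u v) :
    ∃ p : G.Walk u v, 0 < p.length ∧ tokenCount T p = 0 := by
  induction h using Relation.TransGen.head_induction_on with
  | single h => exact ⟨.cons h.1 .nil, Nat.succ_pos _, by rw [tokenCount_cons, h.2]; rfl⟩
  | head h _ ih =>
    obtain ⟨p, -, hp⟩ := ih
    exact ⟨p.cons h.1, Nat.succ_pos _, by rw [tokenCount_cons, h.2, hp]⟩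

theorem IsLive.exists_rank [Finite V] (hT : IsLive G T) :
    ∃ f : V → ℕ, (∀ v, f v ≤ Nat.card V) ∧ ∀ u v, G.Adj u v → T u v = 0 → f u < f v := by
  let r := Relation.TransGen fun u v => G.Adj u v ∧ T u v = 0
  have hirrefl : ∀ u, ¬ r u u := fun u hu => by
    obtain ⟨C, hlength, hC⟩ := exists_walk_tokenCount_eq_zero hu
    exact (hT.tokenCount_pos C hlength).ne' hC
  refine ⟨fun v => {w | r w v}.ncard, fun v => Set.ncard_le_card _, fun u v huv h0 => ?_⟩
  have hruv : r u v := .single ⟨huv, h0⟩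
  exact Set.ncard_lt_ncard <|
    (Set.ssubset_iff_of_subset fun w hw => Relation.TransGen.trans hw hruv).2 ⟨u, hruv, hirrefl u⟩

theorem IsLive.exists_isPotential [Finite V] (hT : IsLive G T) (c : V → V → ℝ) :
    ∃ r y, 1 ≤ r ∧ IsPotential G c T r y := by
  obtain ⟨f, hf, hlt⟩ := hT.exists_rank
  obtain ⟨B, hB⟩ := Finite.bddAbove_range fun a : V × V => c a.1 a.2
  have hmax : 1 ≤ max B 1 := le_max_right _ _
  refine ⟨max B 1 * (Nat.card V + 1), fun v => max B 1 * f v, by nlinarith, fun u v huv => ?_⟩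
  have hcB : c u v ≤ max B 1 := (hB ⟨(u, v), rfl⟩).trans (le_max_left _ _)
  have hstep : (f u : ℝ) + 1 ≤ f v + (Nat.card V + 1) * T u v := by
    norm_cast
    rcases Nat.eq_zero_or_pos (T u v) with h0 | hpos
    · rw [h0, mul_zero, add_zero]
      exact hlt u v huv h0
    · have := Nat.le_mul_of_pos_right (Nat.card V + 1) hpos
      have := hf u
      omega
  calc max B 1 * f u + c u v ≤ max B 1 * (f u + 1) := by linarith
    _ ≤ max B 1 * (f v + (Nat.card V + 1) * T u v) := by gcongr
    _ = max B 1 * f v + max B 1 * (Nat.card V + 1) * T u v := by ring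

theorem IsLive.multiplicity_pos [Finite V] (hT : IsLive G T) {c : V → V → ℕ}
    (hc : ∀ u v, G.Adj u v → 0 < c u v) (u : V) : 0 < multiplicity G c T u := by
  obtain ⟨r, y, hr, hy⟩ := hT.exists_isPotential fun u v => c u v
  have hperiod : (0 : ℝ) < period G c T := by exact_mod_cast period_pos hc T
  have hmul := hperiod.trans_le (hy.period_le hc hr u)
  exact_mod_cast pos_of_mul_pos_right hmul (by linarith)

end Liveness

section Coloring

variable {G : SimpleGraph V} {p : ℝ}

theorem circDist_lt {x y : ℝ} (hx : x ∈ Set.Ico 0 p) (hy : y ∈ Set.Ico 0 p) :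
    circDist p x y < p := by
  rw [Set.mem_Ico] at hx hy
  unfold circDist
  split_ifs <;> linarith

theorem circDist_toIcoMod (hp : 0 < p) (x y : ℝ) :
    circDist p (toIcoMod hp 0 x) (toIcoMod hp 0 y) = toIcoMod hp 0 (y - x) := by
  have hx := toIcoMod_mem_Ico hp 0 x
  have hy := toIcoMod_mem_Ico hp 0 y
  have hxz := toIcoMod_add_toIcoDiv_zsmul hp 0 x
  have hyz := toIcoMod_add_toIcoDiv_zsmul hp 0 y
  rw [Set.mem_Ico] at hx hy
  rw [zsmul_eq_mul] at hxz hyz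
  symm
  rw [toIcoMod_eq_iff, Set.mem_Ico, circDist]
  split_ifs with hxy
  · refine ⟨⟨by linarith, by linarith⟩, toIcoDiv hp 0 y - toIcoDiv hp 0 x, ?_⟩
    rw [zsmul_eq_mul]
    push_cast
    linarith
  · refine ⟨⟨by linarith, by linarith⟩, toIcoDiv hp 0 y - toIcoDiv hp 0 x - 1, ?_⟩
    rw [zsmul_eq_mul]
    push_cast
    linarith

theorem IsPotential.exists_isCircularColoring {c : V → V → ℝ}
    (hc : ∀ u v, G.Adj u v → 0 < c u v) {T : V → V → ℕ}
    (hT : ∀ u v, G.Adj u v → T u v + T v u = 1) (hp : 0 < p) {y : V → ℝ}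
    (hy : IsPotential G c T p y) : ∃ φ, IsCircularColoring G c p φ := by
  refine ⟨fun v => toIcoMod hp 0 (y v), fun v => ?_, fun u v huv => ?_⟩
  · simpa using toIcoMod_mem_Ico hp 0 (y v)
  have hTuv : (T u v : ℝ) + T v u = 1 := by exact_mod_cast hT u v huv
  have hvu : y v + c v u ≤ y u + p * (1 - T u v) := by
    rw [← hTuv, add_sub_cancel_left]
    exact hy v u huv.symm
  have hmem : y v - y u + (T u v : ℤ) • p ∈ Set.Ico 0 (0 + p) := by
    have := hy u v huv
    have := hc u v huv
    have := hc v u huv.symm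
    rw [natCast_zsmul, nsmul_eq_mul]
    constructor <;> linarith
  rw [circDist_toIcoMod, ← toIcoMod_add_zsmul hp 0 _ (T u v : ℤ), (toIcoMod_eq_self hp).2 hmem,
    natCast_zsmul, nsmul_eq_mul]
  linarith [hy u v huv]

/-- The marking of a coloring `φ`: the tokens are on the arcs that pass the origin of the circle,
that is, along which `φ` descends. -/
def descentMarking {α : Type*} [LinearOrder α] (φ : V → α) (u v : V) : ℕ :=
  if φ v < φ u then 1 else 0

theorem finite_range_descentMarking [Finite V] (α : Type*) [LinearOrder α] :
    (Set.range (descentMarking : (V → α) → V → V → ℕ)).Finite := by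
  refine (Set.Finite.pi' fun _ => Set.Finite.pi' fun _ => Set.finite_Iic 1).subset ?_
  rintro _ ⟨φ, rfl⟩ u v
  rw [descentMarking, Set.mem_Iic]
  split_ifs <;> simp

theorem isGood_descentMarking {α : Type*} [LinearOrder α] {φ : V → α}
    (hφ : ∀ u v, G.Adj u v → φ u ≠ φ v) : IsGood G (descentMarking φ) := by
  have hlt : ∀ {u v}, G.Adj u v → descentMarking φ u v = 0 → φ u < φ v := fun huv h0 =>
    (le_of_not_gt fun h => by simp [descentMarking, h] at h0).lt_of_ne (hφ _ _ huv)
  have hle : ∀ {u v} (w : G.Walk u v), tokenCount (descentMarking φ) w = 0 → φ u ≤ φ v := by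
    intro u v w hw
    induction w with
    | nil => exact le_rfl
    | cons huv _ ih =>
      rw [tokenCount_cons, Nat.add_eq_zero_iff] at hw
      exact (hlt huv hw.1).le.trans (ih hw.2)
  refine ⟨fun u C hC => Nat.pos_of_ne_zero fun h0 => ?_, fun u v huv => ?_⟩
  · cases C with
    | nil => exact absurd hC.1 (lt_irrefl 0)
    | cons huv w =>
      rw [tokenCount_cons, Nat.add_eq_zero_iff] at h0
      exact (hlt huv h0.1).not_ge (hle w h0.2)
  · rcases (hφ u v huv).lt_or_gt with h | h <;> simp [descentMarking, h, h.not_gt]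

namespace IsCircularColoring

variable {φ : V → ℝ}

theorem isPotential {c : V → V → ℝ} (hφ : IsCircularColoring G c p φ) :
    IsPotential G c (descentMarking φ) p φ := by
  intro u v huv
  have h := hφ.2 u v huv
  unfold circDist at h
  unfold descentMarking
  split_ifs at h ⊢ <;> push_cast <;> linarith

theorem isGood {c : V → V → ℝ} (hc : ∀ u v, G.Adj u v → 0 < c u v)
    (hφ : IsCircularColoring G c p φ) : IsGood G (descentMarking φ) := by
  refine isGood_descentMarking fun u v huv heq => ?_
  have h := (hc u v huv).trans_le (hφ.2 u v huv)
  rw [heq, circDist, if_pos le_rfl, sub_self] at h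
  exact lt_irrefl 0 h

theorem lt_perimeter {c : V → V → ℝ} (hφ : IsCircularColoring G c p φ) {u v : V}
    (huv : G.Adj u v) : c u v < p :=
  (hφ.2 u v huv).trans_lt (circDist_lt (hφ.1 u) (hφ.1 v))

theorem period_div_multiplicity_le [Finite V] [Nontrivial V] (hG : G.Preconnected)
    {c : V → V → ℕ} (hc : ∀ u v, G.Adj u v → 0 < c u v)
    (hφ : IsCircularColoring G (fun u v => c u v) p φ) (u : V) :
    (period G c (descentMarking φ) : ℝ) / multiplicity G c (descentMarking φ) u ≤ p := by
  obtain ⟨v, huv⟩ := hG.exists_adj_of_nontrivial u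
  have hc₁ : (1 : ℝ) ≤ c u v := by exact_mod_cast hc u v huv
  have hlive : IsLive G (descentMarking φ) :=
    (hφ.isGood fun u v huv => Nat.cast_pos.2 (hc u v huv)).1
  rw [div_le_iff₀ (Nat.cast_pos.2 (hlive.multiplicity_pos hc u))]
  exact hφ.isPotential.period_le hc (hc₁.trans (hφ.lt_perimeter huv).le) u

end IsCircularColoring

theorem IsGood.exists_isCircularColoring [Finite V] (hG : G.Preconnected) {c T : V → V → ℕ}
    (hc : ∀ u v, G.Adj u v → 0 < c u v) (hT : IsGood G T) (u : V) :
    0 < (period G c T : ℝ) / multiplicity G c T u ∧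
      ∃ φ, IsCircularColoring G (fun u v => c u v) (period G c T / multiplicity G c T u) φ := by
  have hm : (0 : ℝ) < multiplicity G c T u :=
    Nat.cast_pos.2 (IsLive.multiplicity_pos hT.1 hc u)
  have hr : 0 < (period G c T : ℝ) / multiplicity G c T u :=
    div_pos (Nat.cast_pos.2 (period_pos hc T)) hm
  obtain ⟨y, hy⟩ := exists_isPotential_of_period_le (T := T) hc hr.le fun v => by
    rw [multiplicity_eq hG hc T v u, div_mul_cancel₀ _ hm.ne']
  exact ⟨hr, hy.exists_isCircularColoring (fun u v huv => Nat.cast_pos.2 (hc u v huv)) hT.2 hr⟩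

theorem exists_isGood_isLeast_perimeter [Finite V] [Nontrivial V] (hG : G.Preconnected)
    {c : V → V → ℕ} (hc : ∀ u v, G.Adj u v → 0 < c u v) (u : V) :
    ∃ T, IsGood G T ∧ IsLeast {p : ℝ | 0 < p ∧ ∃ φ, IsCircularColoring G (fun u v => c u v) p φ}
      (period G c T / multiplicity G c T u) := by
  let B : Set (V → V → ℕ) := {T | IsGood G T} ∩ Set.range (descentMarking (α := ℝ))
  have hBfin : B.Finite := (finite_range_descentMarking ℝ).inter_of_right _
  have hBne : B.Nonempty := by
    obtain ⟨f, hf⟩ := exists_injective_nat V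
    exact ⟨_, isGood_descentMarking fun u v huv heq => huv.ne (hf (Nat.cast_injective heq)),
      fun v => (f v : ℝ), rfl⟩
  obtain ⟨T, hT, hmin⟩ := Set.exists_min_image B
    (fun T => (period G c T : ℝ) / multiplicity G c T u) hBfin hBne
  refine ⟨T, hT.1, hT.1.exists_isCircularColoring hG hc u, ?_⟩
  rintro p ⟨-, φ, hφ⟩
  have hgood := hφ.isGood fun u v huv => Nat.cast_pos.2 (hc u v huv)
  exact (hmin _ ⟨hgood, φ, rfl⟩).trans (hφ.period_div_multiplicity_le hG hc u)

end Coloring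

end TokenGame

open TokenGame in
theorem theorem6_general {V : Type*} [Finite V] [Nontrivial V] (G : SimpleGraph V)
    (hG : G.Connected) (c : V → V → ℕ) (hc : ∀ u v, G.Adj u v → 0 < c u v) :
    (∀ T, ∃ p M, IsPeriodicFrom G c T p M) ∧
    (∀ T u v, multiplicity G c T u = multiplicity G c T v) ∧
    (∀ T, IsLive G T → ∀ u, 0 < multiplicity G c T u) ∧
    ∀ u, IsLeast
      {r : ℝ | ∃ T, IsGood G T ∧ r = (period G c T : ℝ) / (multiplicity G c T u : ℝ)}
      (circularChromaticNumber G fun a b => (c a b : ℝ)) := by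
  refine ⟨exists_isPeriodicFrom hc, multiplicity_eq hG.preconnected hc,
    fun T hT => hT.multiplicity_pos hc, fun u => ?_⟩
  obtain ⟨T, hT, hleast⟩ := exists_isGood_isLeast_perimeter hG.preconnected hc u
  rw [circularChromaticNumber, hleast.csInf_eq]
  refine ⟨⟨T, hT, rfl⟩, ?_⟩
  rintro _ ⟨T', hT', rfl⟩
  exact hleast.2 (hT'.exists_isCircularColoring hG.preconnected hc u)

/-- The first two conjuncts say that the period and the multiplicity are well defined: the token
game is eventually periodic, and the multiplicity is positive and the same for all vertices. -/
theorem theorem6 {V : Type*} [Finite V] [Nontrivial V] (G : SimpleGraph V) (hG : G.Connected)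
    (c : V → V → ℕ) (hc : ∀ u v, G.Adj u v → 0 < c u v) :
    (∀ T, TokenGame.IsGood G T → ∃ p M, TokenGame.IsPeriodicFrom G c T p M) ∧
    (∀ T, TokenGame.IsGood G T → ∀ u v, 0 < TokenGame.multiplicity G c T u ∧
      TokenGame.multiplicity G c T u = TokenGame.multiplicity G c T v) ∧
    ∀ u, IsLeast
      {r : ℝ | ∃ T, TokenGame.IsGood G T ∧
        r = (TokenGame.period G c T : ℝ) / (TokenGame.multiplicity G c T u : ℝ)}
      (TokenGame.circularChromaticNumber G fun a b => (c a b : ℝ)) := by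
  obtain ⟨hper, heq, hpos, hleast⟩ := theorem6_general G hG c hc
  exact ⟨fun T _ => hper T, fun T hT u v => ⟨hpos T hT.1 u, heq T u v⟩, hleast⟩
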